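/- Let $n_1,n_2,m,s$ be nonnegative integers and let $\mathcal A:\mathbb R^{n_1\times n_2}\to\mathbb R^m$ be a linear map with null space $\mathcal N(\mathcal A)$. For $X\in\mathbb R^{n_1\times n_2}$ let $\sigma_1(X)\ge\dots\ge\sigma_{\min\{n_1,n_2\}}(X)$ be its singular values, $\|X\|_*=\sum_i\sigma_i(X)$ its nuclear norm and $\|X\|_F$ its Frobenius norm. Let $Z_s$ denote a best rank-$s$ approximation of $Z$, i.e. a minimizer of $\|Z-V\|_*$ over all $V\in\mathbb R^{n_1\times n_2}$ of rank at most $s$ (for instance the truncated singular value decomposition of $Z$); the numbers $\|Z_s\|_*$ and $\|Z-Z_s\|_*$ do not depend on the choice of $Z_s$. Let $\nu_{\mathcal A}$ be the smallest nonzero singular value of the matrix of $\mathcal A$ in orthonormal bases (with $1/\nu_{\mathcal A}:=0$ if $\mathcal A=0$). Let $Z_0\in\mathbb R^{n_1\times n_2}$, $Y=\mathcal A Z_0+e$ with $\|e\|_2\le\epsilon$, and let $\hat Z$ be any solution of $$\min_{Z\in\mathbb R^{n_1\times n_2}}\|Z\|_*\quad\text{subject to}\quad\|\mathcal A Z-Y\|_2\le\epsilon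 .$$ (a) If $\mathcal A$ has the stable null space property of order $s$ with constant $0<\rho<1$, that is, $\|Z_s\|_*\le\rho\|Z-Z_s\|_*$ for all $Z\in\mathcal N(\mathcal A)$, then $$\|\hat Z-Z_0\|_*\le\frac{2+2\rho}{1-\rho}\|Z_0-(Z_0)_s\|_*+\frac{4\sqrt{n_1n_2}}{(1-\rho)\nu_{\mathcal A}}\,\epsilon .$$ (b) If $\mathcal A$ has the robust null space property of order $s$ with constants $0<\rho<1$ and $\tau>0$, that is, $\|Z_s\|_*\le\rho\|Z-Z_s\|_*+\tau\|\mathcal A Z\|_2$ for all $Z\in\mathbb R^{n_1\times n_2}$, then $$\|\hat Z-Z_0\|_*\le\frac{2(1+\rho)}{1-\rho}\|Z_0-(Z_0)_s\|_*+\frac{4\tau}{1-\rho}\,\epsilon .$$ (c) If $\mathcal A$ has the strong null space property of order $s$ with constant $c>0$, that is, $\|Z-Z_s\|_*-\|Z_s\|_*\ge c\|Z\|_F$ for all $Z\in\mathcal N(\mathcal A)$, then $$\|\hat Z-Z_0\|_F\le\frac{2}{\nu_{\mathcal A}}\left(\frac{\sqrt{n_1n_2}}{c}+1\right)\epsilon+\frac2c\|Z_0-(Z_0)_s\|_*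 .$$ -/

import Mathlib

/-! The norm `‖Z‖` of a real matrix is the Frobenius norm throughout. -/
attribute [local instance] Matrix.frobeniusNormedAddCommGroup

namespace LowRankRecovery

/-- The singular values of a real matrix, in decreasing order (indexed from `0`), followed by
zeros. -/
noncomputable def singVal {κ ι : Type*} [Fintype κ] [Fintype ι] [DecidableEq ι]
    (X : Matrix κ ι ℝ) (i : ℕ) : ℝ :=
  (Matrix.toEuclideanLin X).singularValues i

/-- The nuclear norm: the sum of the `min n₁ n₂` singular values. -/
noncomputable def nuclearNorm {n₁ n₂ : ℕ} (X : Matrix (Fin n₁) (Fin n₂) ℝ) : ℝ :=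
  ∑ i ∈ Finset.range (min n₁ n₂), singVal X i

/-- `V` is a best rank-`s` approximation `Z_s` of `Z`: a minimizer of `‖Z - V‖_*` over all
matrices `V` of rank at most `s`. -/
def IsBestApprox {n₁ n₂ : ℕ} (s : ℕ) (Z V : Matrix (Fin n₁) (Fin n₂) ℝ) : Prop :=
  V.rank ≤ s ∧ ∀ W : Matrix (Fin n₁) (Fin n₂) ℝ, W.rank ≤ s →
    nuclearNorm (Z - V) ≤ nuclearNorm (Z - W)

/-- `ν_A`: the smallest nonzero singular value of the matrix of `A` with respect to the
standard orthonormal bases. (If `A = 0` there is none, and the infimum of the empty set is `0`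
in Lean, so that `x / ν_A` is `0`, as it should be for the infimum `∞`.) -/
noncomputable def minSingVal {n₁ n₂ : ℕ} {ι : Type*} [Fintype ι]
    (A : Matrix (Fin n₁) (Fin n₂) ℝ →ₗ[ℝ] EuclideanSpace ℝ ι) : ℝ :=
  sInf {t : ℝ | 0 < t ∧ ∃ i : ℕ,
    t = singVal (LinearMap.toMatrix (Matrix.stdBasis ℝ (Fin n₁) (Fin n₂))
      (EuclideanSpace.basisFun ι ℝ).toBasis A) i}

/-- Stable rank null space property of order `s` with constant `ρ`. All best approximations
`Z_s` of `Z` have the same nuclear norm, so it does not matter which one is taken; the weakest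
form, with some `Z_s`, is used. -/
def StableNSP {n₁ n₂ : ℕ} {ι : Type*} [Fintype ι]
    (A : Matrix (Fin n₁) (Fin n₂) ℝ →ₗ[ℝ] EuclideanSpace ℝ ι) (s : ℕ) (ρ : ℝ) : Prop :=
  ∀ Z, A Z = 0 → ∃ Zs, IsBestApprox s Z Zs ∧ nuclearNorm Zs ≤ ρ * nuclearNorm (Z - Zs)

/-- Robust rank null space property of order `s` with constants `ρ` and `τ`. -/
def RobustNSP {n₁ n₂ : ℕ} {ι : Type*} [Fintype ι]
    (A : Matrix (Fin n₁) (Fin n₂) ℝ →ₗ[ℝ] EuclideanSpace ℝ ι) (s : ℕ) (ρ τ : ℝ) : Prop :=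
  ∀ Z, ∃ Zs, IsBestApprox s Z Zs ∧
    nuclearNorm Zs ≤ ρ * nuclearNorm (Z - Zs) + τ * ‖A Z‖

/-- Strong rank null space property of order `s` with constant `c`. -/
def StrongNSP {n₁ n₂ : ℕ} {ι : Type*} [Fintype ι]
    (A : Matrix (Fin n₁) (Fin n₂) ℝ →ₗ[ℝ] EuclideanSpace ℝ ι) (s : ℕ) (c : ℝ) : Prop :=
  ∀ Z, A Z = 0 → ∃ Zs, IsBestApprox s Z Zs ∧ c * ‖Z‖ ≤ nuclearNorm (Z - Zs) - nuclearNorm Zs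

/-- `Zhat` solves the problem: minimize `‖Z‖_*` subject to `‖A Z - Y‖ ≤ ε`. -/
def IsNuclearMinimizer {n₁ n₂ : ℕ} {ι : Type*} [Fintype ι]
    (A : Matrix (Fin n₁) (Fin n₂) ℝ →ₗ[ℝ] EuclideanSpace ℝ ι) (Y : EuclideanSpace ℝ ι) (ε : ℝ)
    (Zhat : Matrix (Fin n₁) (Fin n₂) ℝ) : Prop :=
  ‖A Zhat - Y‖ ≤ ε ∧ ∀ Z, ‖A Z - Y‖ ≤ ε → nuclearNorm Zhat ≤ nuclearNorm Z

end LowRankRecovery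

/-! Everything rests on Mirsky's inequality `∑ |σ_i(X) - σ_i(Y)| ≤ ‖X - Y‖_*`
(`sum_abs_singVal_sub_le`). It makes every sum `∑ w_i σ_i(X)` with `|w_i| ≤ 1` 1-Lipschitz in the
nuclear norm, so the vector proofs from compressed sensing carry over with head and tail sums of
singular values in place of coordinates on and off a support. It also identifies the best rank-`s`
error with the tail sum.

For Mirsky, one symmetric operator `C` on `E × F` is built that dominates the dilations of both
maps. Its top eigenvalues exceed the larger of the two singular values and its bottom ones exceed
minus the smaller, so its trace, which is `‖X - Y‖_*`, bounds the sum of the differences.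

Put `H = Zhat - Z₀`. Minimality gives `tail H ≤ head H + 2 tail Z₀`, and feasibility gives `‖A H‖ ≤
2ε`. The robust property applies to `H` itself. For the other two, `H` is replaced by a kernel
element `K` with `‖H - K‖_F ≤ ‖A H‖ / ν_A`, at the cost of a factor `√(n₁ n₂)` between the norms. -/

section

open InnerProductSpace Module

/-! ### Eigenvalue bounds and the singular value decomposition -/

namespace LinearMap

/-- The easy half of the Courant-Fischer theorem: if the quadratic form of `C` is at least `a` on
the unit sphere of a subspace of dimension greater than `k`, then the `k`-th eigenvalue is at
least `a`. -/
theorem IsSymmetric.le_eigenvalues_of_lt_finrank {G : Type*} [NormedAddCommGroup G]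
    [InnerProductSpace ℝ G] [FiniteDimensional ℝ G] {C : G →ₗ[ℝ] G} (hC : C.IsSymmetric) {N : ℕ}
    (hN : finrank ℝ G = N) (k : Fin N) (S : Submodule ℝ G) (hS : (k : ℕ) < finrank ℝ S) (a : ℝ)
    (h : ∀ z ∈ S, a * ‖z‖ ^ 2 ≤ ⟪C z, z⟫_ℝ) : a ≤ hC.eigenvalues hN k := by
  let b := hC.eigenvectorBasis hN
  let φ : S →ₗ[ℝ] (Fin k → ℝ) :=
    LinearMap.pi fun j => (innerₛₗ ℝ (b ⟨j, j.2.trans k.2⟩)).comp S.subtype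
  have hker : LinearMap.ker φ ≠ ⊥ := LinearMap.ker_ne_bot_of_finrank_lt (by simpa using hS)
  obtain ⟨z, hz, hz0⟩ := (Submodule.ne_bot_iff _).1 hker
  have hzero : ∀ j : Fin N, (j : ℕ) < k → ⟪b j, (z : G)⟫_ℝ = 0 := by
    intro j hj
    have := congrFun (LinearMap.mem_ker.1 hz) ⟨j, hj⟩
    simpa [φ] using this
  have hq : ⟪C z, (z : G)⟫_ℝ = ∑ j, hC.eigenvalues hN j * ⟪b j, (z : G)⟫_ℝ ^ 2 := by
    rw [← b.sum_inner_mul_inner]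
    refine Finset.sum_congr rfl fun j _ => ?_
    rw [hC, hC.apply_eigenvectorBasis hN, inner_smul_right, real_inner_comm]
    simp only [RCLike.ofReal_real_eq_id, id_eq, b]
    ring
  have hn : ‖(z : G)‖ ^ 2 = ∑ j, ⟪b j, (z : G)⟫_ℝ ^ 2 := by
    rw [← b.sum_sq_norm_inner_right]
    simp
  have hpos : 0 < ‖(z : G)‖ ^ 2 := by
    have : (z : G) ≠ 0 := by simpa using hz0
    positivity
  have hle : ⟪C z, (z : G)⟫_ℝ ≤ hC.eigenvalues hN k * ‖(z : G)‖ ^ 2 := by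
    rw [hq, hn, Finset.mul_sum]
    refine Finset.sum_le_sum fun j _ => ?_
    rcases lt_or_ge (j : ℕ) k with hj | hj
    · simp [hzero j hj]
    · exact mul_le_mul_of_nonneg_right (hC.eigenvalues_antitone hN hj) (sq_nonneg _)
  exact le_of_mul_le_mul_right ((h z z.2).trans hle) hpos

variable {E F : Type*} [NormedAddCommGroup E] [InnerProductSpace ℝ E] [FiniteDimensional ℝ E]
  [NormedAddCommGroup F] [InnerProductSpace ℝ F] [FiniteDimensional ℝ F]

theorem singularValues_eq_zero_of_min_finrank_le (T : E →ₗ[ℝ] F) {i : ℕ}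
    (hi : min (finrank ℝ E) (finrank ℝ F) ≤ i) : T.singularValues i = 0 :=
  T.singularValues_eq_zero_iff_le_finrank_range.2
    ((le_min (finrank_range_le T) (Submodule.finrank_le _)).trans hi)

theorem inner_map_eigenvectorBasis (T : E →ₗ[ℝ] F) {n : ℕ} (hn : finrank ℝ E = n) (i j : Fin n) :
    ⟪T (T.isSymmetric_adjoint_comp_self.eigenvectorBasis hn i),
      T (T.isSymmetric_adjoint_comp_self.eigenvectorBasis hn j)⟫_ℝ =
      if i = j then T.singularValues i ^ 2 else 0 := by
  rw [← LinearMap.adjoint_inner_left]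
  have h := T.isSymmetric_adjoint_comp_self.apply_eigenvectorBasis hn i
  rw [LinearMap.comp_apply] at h
  rw [h, ← T.sq_singularValues_fin hn i, real_inner_smul_left, OrthonormalBasis.inner_eq_ite]
  simp

/-- Singular value decomposition. -/
theorem exists_singularValue_decomposition (T : E →ₗ[ℝ] F) {r : ℕ}
    (hr : r = min (finrank ℝ E) (finrank ℝ F)) :
    ∃ (v : Fin r → E) (u : Fin r → F), Orthonormal ℝ v ∧ Orthonormal ℝ u ∧
      T = ∑ j : Fin r, T.singularValues j • (rankOne ℝ (u j) (v j) : E →ₗ[ℝ] F) := by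
  let b := T.isSymmetric_adjoint_comp_self.eigenvectorBasis rfl
  -- Normalized images of the eigenvectors of `T† T`. They are orthonormal where the singular value
  -- is nonzero; extending that family to a basis of `F` supplies the remaining left vectors.
  let u₀ : Fin (finrank ℝ F) → F := fun i =>
    if h : (i : ℕ) < finrank ℝ E then (T.singularValues i)⁻¹ • T (b ⟨i, h⟩) else 0
  let s : Set (Fin (finrank ℝ F)) := {i | T.singularValues i ≠ 0}
  have hs : ∀ i ∈ s, (i : ℕ) < finrank ℝ E := fun i hi => by
    by_contra h
    exact hi (T.singularValues_of_finrank_le (not_lt.1 h))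
  have hu₀ : Orthonormal ℝ (s.domRestrict u₀) := by
    rw [orthonormal_iff_ite]
    rintro ⟨i, hi⟩ ⟨j, hj⟩
    simp only [Set.domRestrict_apply, u₀, dif_pos (hs i hi), dif_pos (hs j hj),
      real_inner_smul_left, real_inner_smul_right, b, T.inner_map_eigenvectorBasis rfl,
      Subtype.mk.injEq, Fin.mk.injEq, Fin.val_inj]
    split_ifs with h
    · subst h
      have : T.singularValues i ≠ 0 := hi
      field_simp
    · simp
  obtain ⟨c, hc⟩ := hu₀.exists_orthonormalBasis_extension_of_card_eq (by simp)
  have h1 : r ≤ finrank ℝ E := hr ▸ min_le_left _ _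
  have h2 : r ≤ finrank ℝ F := hr ▸ min_le_right _ _
  refine ⟨fun j => b (Fin.castLE h1 j), fun j => c (Fin.castLE h2 j),
    b.orthonormal.comp _ (Fin.castLE_injective h1), c.orthonormal.comp _ (Fin.castLE_injective h2),
    b.toBasis.ext fun i => ?_⟩
  simp only [OrthonormalBasis.coe_toBasis, LinearMap.sum_apply, LinearMap.smul_apply,
    ContinuousLinearMap.coe_coe, rankOne_apply, OrthonormalBasis.inner_eq_ite]
  have hz : T.singularValues i = 0 → T (b i) = 0 := fun h => by
    have := T.inner_map_eigenvectorBasis rfl i i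
    simpa [h] using this
  rcases lt_or_ge (i : ℕ) r with hi | hi
  · rw [Finset.sum_eq_single ⟨i, hi⟩]
    · by_cases h0 : T.singularValues i = 0
      · simp [h0, hz h0]
      · have := hc ⟨i, hi.trans_le h2⟩ h0
        simp [Fin.castLE, this, u₀, smul_smul, h0]
    · intro j _ hj
      rw [if_neg]
      · simp
      · rintro rfl
        simp at hj
    · simp
  · rw [hz (T.singularValues_eq_zero_of_min_finrank_le (hr ▸ hi)), Finset.sum_eq_zero]
    intro j _
    rw [if_neg]
    · simp
    · rintro rfl
      simp only [Fin.val_castLE] at hi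
      omega

theorem inner_map_eq_sum_singularValues {T : E →ₗ[ℝ] F} {r : ℕ} {v : Fin r → E} {u : Fin r → F}
    (hT : T = ∑ j : Fin r, T.singularValues j • (rankOne ℝ (u j) (v j) : E →ₗ[ℝ] F)) (x : E) (y : F) :
    ⟪T x, y⟫_ℝ = ∑ j : Fin r, T.singularValues j * (⟪v j, x⟫_ℝ * ⟪u j, y⟫_ℝ) := by
  conv_lhs => rw [hT]
  simp [sum_inner, real_inner_smul_left]

/-! ### Eigenvalues of an operator dominating a dilation -/

/-- The test space is the span of the pairs `(v_j, u_j)` with `j ≤ k`, of dimension `k + 1`. There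
`2⟪T x, y⟫` is at least `σ_k ‖(x, y)‖²`. -/
theorem singularValues_le_eigenvalues (T : E →ₗ[ℝ] F)
    {C : WithLp 2 (E × F) →ₗ[ℝ] WithLp 2 (E × F)} (hC : C.IsSymmetric) {N : ℕ}
    (hN : finrank ℝ (WithLp 2 (E × F)) = N)
    (h : ∀ z, 2 * ⟪T z.fst, z.snd⟫_ℝ ≤ ⟪C z, z⟫_ℝ) (k : Fin N)
    (hk : (k : ℕ) < min (finrank ℝ E) (finrank ℝ F)) :
    T.singularValues k ≤ hC.eigenvalues hN k := by
  obtain ⟨v, u, hv, hu, hT⟩ := T.exists_singularValue_decomposition rfl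
  have hk' : (k : ℕ) + 1 ≤ min (finrank ℝ E) (finrank ℝ F) := hk
  let v' : Fin (k + 1) → E := fun j => v (Fin.castLE hk' j)
  let u' : Fin (k + 1) → F := fun j => u (Fin.castLE hk' j)
  have hv' : Orthonormal ℝ v' := hv.comp _ (Fin.castLE_injective hk')
  have hu' : Orthonormal ℝ u' := hu.comp _ (Fin.castLE_injective hk')
  let φ : (Fin (k + 1) → ℝ) →ₗ[ℝ] WithLp 2 (E × F) :=
    (WithLp.linearEquiv 2 ℝ (E × F)).symm.toLinearMap.comp
      ((Fintype.linearCombination ℝ v').prod (Fintype.linearCombination ℝ u'))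
  have hfst : ∀ c, (φ c).fst = ∑ j, c j • v' j := fun c => rfl
  have hsnd : ∀ c, (φ c).snd = ∑ j, c j • u' j := fun c => rfl
  have hnv : ∀ c : Fin (k + 1) → ℝ, ‖∑ j, c j • v' j‖ ^ 2 = ∑ j, c j ^ 2 := fun c => by
    rw [← real_inner_self_eq_norm_sq, hv'.inner_sum]
    simp [sq]
  have hnu : ∀ c : Fin (k + 1) → ℝ, ‖∑ j, c j • u' j‖ ^ 2 = ∑ j, c j ^ 2 := fun c => by
    rw [← real_inner_self_eq_norm_sq, hu'.inner_sum]
    simp [sq]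
  have hnorm : ∀ c, ‖φ c‖ ^ 2 = 2 * ∑ j, c j ^ 2 := fun c => by
    rw [WithLp.prod_norm_sq_eq_of_L2, hfst, hsnd, hnv, hnu]
    ring
  have hinj : Function.Injective φ := by
    rw [injective_iff_map_eq_zero]
    intro c hc
    have := hnorm c
    rw [hc] at this
    have h0 : ∑ j, c j ^ 2 = 0 := by simpa using this.symm
    rw [Finset.sum_eq_zero_iff_of_nonneg fun _ _ => sq_nonneg _] at h0
    ext j
    simpa using h0 j
  refine hC.le_eigenvalues_of_lt_finrank hN k (LinearMap.range φ) ?_ _ ?_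
  · rw [LinearMap.finrank_range_of_inj hinj]
    simp
  · rintro _ ⟨c, rfl⟩
    refine le_trans ?_ (h _)
    have hTv : ∀ j, T (v' j) = T.singularValues j • u' j := fun j => by
      conv_lhs => rw [hT]
      simp [v', u', orthonormal_iff_ite.1 hv]
    have : ⟪T (φ c).fst, (φ c).snd⟫_ℝ = ∑ j : Fin (k + 1), T.singularValues j * c j ^ 2 := by
      rw [hfst, hsnd, map_sum]
      simp_rw [map_smul, hTv, smul_smul]
      rw [hu'.inner_sum]
      simp only [conj_trivial]
      exact Finset.sum_congr rfl fun j _ => by ring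
    rw [this, hnorm, mul_left_comm, Finset.mul_sum]
    gcongr with j
    exact T.singularValues_antitone (Nat.lt_succ_iff.1 j.2)

/-- The test space is cut out by the `i` equations `⟪v_j, x⟫ = ⟪u_j, y⟫`, `j < i`. On it the first
`i` terms of `2⟪T x, y⟫` are nonnegative; the others are at least `-σ_i (⟪v_j, x⟫² + ⟪u_j, y⟫²)`,
and Bessel's inequality sums these. -/
theorem neg_singularValues_le_eigenvalues (T : E →ₗ[ℝ] F)
    {C : WithLp 2 (E × F) →ₗ[ℝ] WithLp 2 (E × F)} (hC : C.IsSymmetric) {N : ℕ}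
    (hN : finrank ℝ (WithLp 2 (E × F)) = N)
    (h : ∀ z, 2 * ⟪T z.fst, z.snd⟫_ℝ ≤ ⟪C z, z⟫_ℝ) (k : Fin N) {i : ℕ}
    (hi : i ≤ min (finrank ℝ E) (finrank ℝ F)) (hk : (k : ℕ) + i < N) :
    -T.singularValues i ≤ hC.eigenvalues hN k := by
  obtain ⟨v, u, hv, hu, hT⟩ := T.exists_singularValue_decomposition rfl
  let φ : WithLp 2 (E × F) →ₗ[ℝ] (Fin i → ℝ) := LinearMap.comp
    (LinearMap.pi fun j =>
      (innerₛₗ ℝ (v (Fin.castLE hi j))).comp (LinearMap.fst ℝ E F) -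
        (innerₛₗ ℝ (u (Fin.castLE hi j))).comp (LinearMap.snd ℝ E F))
    (WithLp.linearEquiv 2 ℝ (E × F)).toLinearMap
  refine hC.le_eigenvalues_of_lt_finrank hN k (LinearMap.ker φ) ?_ _ ?_
  · have h1 := φ.finrank_range_add_finrank_ker
    have h2 : finrank ℝ (LinearMap.range φ) ≤ i := by
      simpa using Submodule.finrank_le (LinearMap.range φ)
    omega
  · intro z hz
    refine le_trans ?_ (h z)
    have heq : ∀ j : Fin (min (finrank ℝ E) (finrank ℝ F)), (j : ℕ) < i → ⟪v j, z.fst⟫_ℝ = ⟪u j, z.snd⟫_ℝ := fun j hj =>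
      sub_eq_zero.1 (congrFun (LinearMap.mem_ker.1 hz) ⟨j, hj⟩)
    have hb1 : ∑ j, ⟪v j, z.fst⟫_ℝ ^ 2 ≤ ‖z.fst‖ ^ 2 := by
      simpa using hv.sum_inner_products_le (s := Finset.univ) z.fst
    have hb2 : ∑ j, ⟪u j, z.snd⟫_ℝ ^ 2 ≤ ‖z.snd‖ ^ 2 := by
      simpa using hu.sum_inner_products_le (s := Finset.univ) z.snd
    have hterm : -T.singularValues i * ∑ j, (⟪v j, z.fst⟫_ℝ ^ 2 + ⟪u j, z.snd⟫_ℝ ^ 2) ≤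
        2 * ⟪T z.fst, z.snd⟫_ℝ := by
      rw [inner_map_eq_sum_singularValues hT, Finset.mul_sum, Finset.mul_sum]
      refine Finset.sum_le_sum fun j _ => ?_
      have h0 := T.singularValues_nonneg i
      have h0' := T.singularValues_nonneg j
      rcases lt_or_ge (j : ℕ) i with hj | hj
      · rw [heq j hj]
        have : 0 ≤ T.singularValues i * ⟪u j, z.snd⟫_ℝ ^ 2 := by positivity
        have : 0 ≤ T.singularValues j * ⟪u j, z.snd⟫_ℝ ^ 2 := by positivity
        linarith
      · have hle := T.singularValues_antitone hj
        have := mul_nonneg h0' (sq_nonneg (⟪v j, z.fst⟫_ℝ + ⟪u j, z.snd⟫_ℝ))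
        have := mul_le_mul_of_nonneg_right hle
          (by positivity : 0 ≤ ⟪v j, z.fst⟫_ℝ ^ 2 + ⟪u j, z.snd⟫_ℝ ^ 2)
        linarith
    refine le_trans ?_ hterm
    rw [neg_mul, neg_mul, neg_le_neg_iff, WithLp.prod_norm_sq_eq_of_L2, Finset.sum_add_distrib]
    gcongr
    exact T.singularValues_nonneg i

end LinearMap

/-- The first `r` terms of `f` are compared with `a`, the last `r`, in reverse order, with `-b`, and
those between with `-b r = 0`. -/
theorem sum_range_sub_le_sum_range {f a b : ℕ → ℝ} {r N : ℕ} (hN : 2 * r ≤ N) (hb : b r = 0)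
    (h1 : ∀ k < r, a k ≤ f k) (h2 : ∀ k i, i ≤ r → k + i < N → -b i ≤ f k) :
    ∑ k ∈ Finset.range r, (a k - b k) ≤ ∑ k ∈ Finset.range N, f k := by
  obtain ⟨M, rfl⟩ : ∃ M, N = r + (M + r) := ⟨N - 2 * r, by omega⟩
  rw [Finset.sum_range_add, Finset.sum_range_add, Finset.sum_sub_distrib, sub_eq_add_neg,
    ← Finset.sum_neg_distrib]
  have hA : ∑ k ∈ Finset.range r, a k ≤ ∑ k ∈ Finset.range r, f k :=
    Finset.sum_le_sum fun k hk => h1 k (Finset.mem_range.1 hk)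
  have hM : 0 ≤ ∑ k ∈ Finset.range M, f (r + k) := Finset.sum_nonneg fun k hk => by
    have := h2 (r + k) r le_rfl (by have := Finset.mem_range.1 hk; omega)
    rwa [hb, neg_zero] at this
  have hB : ∑ k ∈ Finset.range r, -b k ≤ ∑ k ∈ Finset.range r, f (r + (M + k)) := by
    rw [← Finset.sum_range_reflect (fun k => f (r + (M + k))) r]
    refine Finset.sum_le_sum fun k hk => h2 _ _ (Finset.mem_range.1 hk).le ?_
    have := Finset.mem_range.1 hk
    omega
  linarith

/-! ### The self-adjoint dilation and Mirsky's inequality -/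

namespace LinearMap

variable {E F : Type*} [NormedAddCommGroup E] [InnerProductSpace ℝ E] [FiniteDimensional ℝ E]
  [NormedAddCommGroup F] [InnerProductSpace ℝ F] [FiniteDimensional ℝ F]

/-- The self-adjoint dilation `(x, y) ↦ (T† y, T x)`. -/
noncomputable def selfAdjointDilation (T : E →ₗ[ℝ] F) :
    WithLp 2 (E × F) →ₗ[ℝ] WithLp 2 (E × F) :=
  (WithLp.linearEquiv 2 ℝ (E × F)).symm.toLinearMap.comp
    (((T.adjoint.comp (LinearMap.snd ℝ E F)).prod (T.comp (LinearMap.fst ℝ E F))).comp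
      (WithLp.linearEquiv 2 ℝ (E × F)).toLinearMap)

theorem inner_selfAdjointDilation (T : E →ₗ[ℝ] F) (z w : WithLp 2 (E × F)) :
    ⟪T.selfAdjointDilation z, w⟫_ℝ = ⟪T z.fst, w.snd⟫_ℝ + ⟪T w.fst, z.snd⟫_ℝ := by
  rw [WithLp.prod_inner_apply]
  change ⟪T.adjoint z.snd, w.fst⟫_ℝ + ⟪T z.fst, w.snd⟫_ℝ = _
  rw [LinearMap.adjoint_inner_left, real_inner_comm, add_comm]

theorem isSymmetric_selfAdjointDilation (T : E →ₗ[ℝ] F) : T.selfAdjointDilation.IsSymmetric := by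
  intro z w
  rw [real_inner_comm _ z, inner_selfAdjointDilation, inner_selfAdjointDilation, add_comm]

theorem trace_selfAdjointDilation (T : E →ₗ[ℝ] F) :
    LinearMap.trace ℝ _ T.selfAdjointDilation = 0 := by
  rw [LinearMap.trace_eq_sum_inner _
    ((stdOrthonormalBasis ℝ E).prod (stdOrthonormalBasis ℝ F))]
  have h : ∀ z, ⟪z, T.selfAdjointDilation z⟫_ℝ = 2 * ⟪T z.fst, z.snd⟫_ℝ := fun z => by
    rw [real_inner_comm, inner_selfAdjointDilation, two_mul]
  simp [h, -WithLp.prod_inner_apply]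

/-- **Mirsky's inequality** for the trace norm: the singular values of `T` and `T'` differ, in
the `ℓ¹` sense, by at most the total weight of a representation of `T' - T` as a combination of
rank-one maps between unit vectors. -/
theorem sum_abs_singularValues_sub_le {K : Type*} [Fintype K] (T T' : E →ₗ[ℝ] F) (t : K → ℝ)
    (a : K → F) (b : K → E) (ht : ∀ k, 0 ≤ t k) (ha : ∀ k, ‖a k‖ = 1) (hb : ∀ k, ‖b k‖ = 1)
    (h : T' = T + ∑ k, t k • (rankOne ℝ (a k) (b k) : E →ₗ[ℝ] F)) :
    ∑ i ∈ Finset.range (min (finrank ℝ E) (finrank ℝ F)),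
      |T'.singularValues i - T.singularValues i| ≤ ∑ k, t k := by
  let w : K → WithLp 2 (E × F) := fun k => WithLp.toLp 2 (b k, a k)
  -- The added part is positive, so `C` dominates the dilation of `T`; since `2αβ ≤ (α + β)² / 2`,
  -- it also dominates that of `T'`. As `‖w k‖² = 2`, the weight `t k / 2` contributes exactly `t k`
  -- to the trace.
  let C : WithLp 2 (E × F) →ₗ[ℝ] WithLp 2 (E × F) := T.selfAdjointDilation +
    ∑ k, (t k / 2) • (rankOne ℝ (w k) (w k) : WithLp 2 (E × F) →ₗ[ℝ] WithLp 2 (E × F))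
  have hw : ∀ k z, ⟪w k, z⟫_ℝ = ⟪b k, z.fst⟫_ℝ + ⟪a k, z.snd⟫_ℝ := fun k z => by
    rw [WithLp.prod_inner_apply]; rfl
  have hCin : ∀ z y, ⟪C z, y⟫_ℝ = ⟪T.selfAdjointDilation z, y⟫_ℝ +
      ∑ k, t k / 2 * (⟪w k, z⟫_ℝ * ⟪w k, y⟫_ℝ) := fun z y => by
    simp [C, inner_add_left, sum_inner, real_inner_smul_left, -WithLp.prod_inner_apply]
  have hC : C.IsSymmetric := fun z y => by
    rw [real_inner_comm _ z, hCin, hCin, T.isSymmetric_selfAdjointDilation z y,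
      real_inner_comm _ z]
    simp_rw [mul_comm ⟪w _, z⟫_ℝ]
  have hq : ∀ z, ⟪C z, z⟫_ℝ = 2 * ⟪T z.fst, z.snd⟫_ℝ +
      ∑ k, t k / 2 * (⟪b k, z.fst⟫_ℝ + ⟪a k, z.snd⟫_ℝ) ^ 2 := fun z => by
    simp_rw [hCin, inner_selfAdjointDilation, hw]
    simp_rw [sq, two_mul]
  have hT : ∀ z, 2 * ⟪T z.fst, z.snd⟫_ℝ ≤ ⟪C z, z⟫_ℝ := fun z => by
    rw [hq, le_add_iff_nonneg_right]
    exact Finset.sum_nonneg fun k _ => mul_nonneg (by linarith [ht k]) (sq_nonneg _)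
  have hT' : ∀ z, 2 * ⟪T' z.fst, z.snd⟫_ℝ ≤ ⟪C z, z⟫_ℝ := fun z => by
    rw [hq, h]
    simp only [LinearMap.add_apply, LinearMap.sum_apply, LinearMap.smul_apply,
      ContinuousLinearMap.coe_coe, rankOne_apply, inner_add_left, sum_inner, real_inner_smul_left,
      mul_add, Finset.mul_sum]
    refine add_le_add_right (Finset.sum_le_sum fun k _ => ?_) _
    nlinarith [mul_nonneg (ht k) (sq_nonneg (⟪b k, z.fst⟫_ℝ - ⟪a k, z.snd⟫_ℝ))]
  have htr : LinearMap.trace ℝ _ C = ∑ k, t k := by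
    rw [map_add, trace_selfAdjointDilation, zero_add, map_sum]
    refine Finset.sum_congr rfl fun k _ => ?_
    rw [map_smul, trace_rankOne, hw]
    change _ • (⟪b k, b k⟫_ℝ + ⟪a k, a k⟫_ℝ) = _
    rw [real_inner_self_eq_norm_sq, real_inner_self_eq_norm_sq, ha, hb]
    simp
    ring
  have hN : finrank ℝ (WithLp 2 (E × F)) = finrank ℝ E + finrank ℝ F := by
    rw [(WithLp.linearEquiv 2 ℝ (E × F)).finrank_eq, finrank_prod]
  rw [← htr, hC.trace_eq_sum_eigenvalues hN]
  let f : ℕ → ℝ := fun k => if hk : k < finrank ℝ E + finrank ℝ F then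
    hC.eigenvalues hN ⟨k, hk⟩ else 0
  have hf : ∀ k : Fin (finrank ℝ E + finrank ℝ F), f k = hC.eigenvalues hN k := fun k => by
    simp [f]
  have key := sum_range_sub_le_sum_range (f := f)
    (a := fun i => max (T'.singularValues i) (T.singularValues i))
    (b := fun i => min (T'.singularValues i) (T.singularValues i))
    (r := min (finrank ℝ E) (finrank ℝ F)) (N := finrank ℝ E + finrank ℝ F) (by omega)
    (by simp [singularValues_eq_zero_of_min_finrank_le])
    (fun k hk => by
      have hk' : k < finrank ℝ E + finrank ℝ F := by omega
      rw [hf ⟨k, hk'⟩]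
      exact max_le (T'.singularValues_le_eigenvalues hC hN hT' ⟨k, hk'⟩ hk)
        (T.singularValues_le_eigenvalues hC hN hT ⟨k, hk'⟩ hk))
    (fun k i hi hk => by
      have hk' : k < finrank ℝ E + finrank ℝ F := by omega
      rw [hf ⟨k, hk'⟩, neg_le]
      exact le_min (neg_le.1 <| T'.neg_singularValues_le_eigenvalues hC hN hT' ⟨k, hk'⟩ hi hk)
        (neg_le.1 <| T.neg_singularValues_le_eigenvalues hC hN hT ⟨k, hk'⟩ hi hk))
  rw [Finset.sum_range f] at key
  simp_rw [hf, max_sub_min_eq_abs'] at key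
  exact_mod_cast key

end LinearMap

/-! ### Distance to the kernel and truncation -/

namespace LinearMap

variable {E F : Type*} [NormedAddCommGroup E] [InnerProductSpace ℝ E] [FiniteDimensional ℝ E]
  [NormedAddCommGroup F] [InnerProductSpace ℝ F] [FiniteDimensional ℝ F]

theorem singularValues_neg (T : E →ₗ[ℝ] F) : (-T).singularValues = T.singularValues := by
  ext i
  have h : (-T).adjoint ∘ₗ (-T) = T.adjoint ∘ₗ T := by
    ext x
    simp
  rcases lt_or_ge i (finrank ℝ E) with hi | hi
  · rw [singularValues_of_lt _ rfl hi, singularValues_of_lt _ rfl hi]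
    simp only [h]
  · rw [singularValues_of_finrank_le _ hi, singularValues_of_finrank_le _ hi]

theorem norm_sq_map_eq_sum (T : E →ₗ[ℝ] F) {n : ℕ} (hn : finrank ℝ E = n) (x : E) :
    ‖T x‖ ^ 2 = ∑ i : Fin n, T.singularValues i ^ 2 *
      ⟪T.isSymmetric_adjoint_comp_self.eigenvectorBasis hn i, x⟫_ℝ ^ 2 := by
  have hS := T.isSymmetric_adjoint_comp_self
  rw [← real_inner_self_eq_norm_sq, ← LinearMap.adjoint_inner_left, ← LinearMap.comp_apply,
    ← (hS.eigenvectorBasis hn).sum_inner_mul_inner]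
  refine Finset.sum_congr rfl fun i _ => ?_
  rw [hS, hS.apply_eigenvectorBasis hn, inner_smul_right, real_inner_comm,
    T.sq_singularValues_fin hn i]
  simp only [RCLike.ofReal_real_eq_id, id_eq]
  ring

/-- A vector is at distance at most `‖T x‖ / ν` from the kernel of `T`, where `ν` is the smallest
nonzero singular value. -/
theorem exists_mem_ker_norm_sub_le (T : E →ₗ[ℝ] F) (x : E) :
    ∃ y, T y = 0 ∧ ‖x - y‖ ≤ ‖T x‖ / sInf {t : ℝ | 0 < t ∧ ∃ i : ℕ, t = T.singularValues i} := by
  set S := {t : ℝ | 0 < t ∧ ∃ i : ℕ, t = T.singularValues i} with hS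
  let b := T.isSymmetric_adjoint_comp_self.eigenvectorBasis rfl
  -- The orthogonal projection of `x` to the kernel, in the eigenbasis of `T† T`.
  let y : E := ∑ i : Fin (finrank ℝ E), (if T.singularValues i = 0 then ⟪b i, x⟫_ℝ else 0) • b i
  have hy : ∀ i, ⟪b i, y⟫_ℝ = if T.singularValues i = 0 then ⟪b i, x⟫_ℝ else 0 := fun i =>
    b.orthonormal.inner_right_fintype _ i
  have hTy : T y = 0 := by
    have h := T.norm_sq_map_eq_sum rfl y
    rw [Finset.sum_eq_zero] at h
    · simpa using h
    · intro i _
      change _ * ⟪b i, y⟫_ℝ ^ 2 = 0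
      rw [hy]
      split_ifs with h0 <;> simp [h0]
  have hxy : ‖x - y‖ ^ 2 = ∑ i : Fin (finrank ℝ E), (if T.singularValues i = 0 then 0 else ⟪b i, x⟫_ℝ) ^ 2 := by
    rw [← b.sum_sq_norm_inner_right]
    refine Finset.sum_congr rfl fun i _ => ?_
    rw [inner_sub_right, hy]
    split_ifs <;> simp
  refine ⟨y, hTy, ?_⟩
  rcases S.eq_empty_or_nonempty with hE | hne
  -- With no nonzero singular value the bound reads `‖x - y‖ ≤ 0`, division by `sInf ∅ = 0` giving
  -- `0`; indeed `y = x`.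
  · have h0 : ∀ i : ℕ, T.singularValues i = 0 := fun i => by
      by_contra h
      have : T.singularValues i ∈ S := ⟨(T.singularValues_pos_iff_ne_zero i).2 h, i, rfl⟩
      rw [hE] at this
      exact this
    have : ‖x - y‖ = 0 := by simpa [h0] using hxy
    rw [this, hE]
    simp
  · have hfin : S.Finite := by
      refine (T.singularValues.support.finite_toSet.image T.singularValues).subset ?_
      rintro _ ⟨hpos, i, rfl⟩
      exact ⟨i, by simpa [-support_singularValues] using hpos.ne', rfl⟩
    have hν : 0 < sInf S := (hne.csInf_mem hfin).1
    have hle : ∀ i : ℕ, T.singularValues i ≠ 0 → sInf S ≤ T.singularValues i := fun i h =>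
      csInf_le hfin.bddBelow ⟨(T.singularValues_pos_iff_ne_zero i).2 h, i, rfl⟩
    rw [le_div_iff₀ hν]
    refine le_of_sq_le_sq ?_ (norm_nonneg _)
    rw [mul_pow, hxy, T.norm_sq_map_eq_sum rfl x, Finset.sum_mul]
    refine Finset.sum_le_sum fun i _ => ?_
    split_ifs with h0
    · simp [h0]
    · rw [mul_comm]
      have := hle i h0
      change _ ≤ _ * ⟪b i, x⟫_ℝ ^ 2
      gcongr

/-- Truncated singular value decomposition. -/
theorem exists_finrank_range_le_sum_singularValues_sub_le (T : E →ₗ[ℝ] F) (s : ℕ) :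
    ∃ V : E →ₗ[ℝ] F, finrank ℝ (LinearMap.range V) ≤ s ∧
      ∑ i ∈ Finset.range (min (finrank ℝ E) (finrank ℝ F)), (T - V).singularValues i ≤
        ∑ i ∈ Finset.range (min (finrank ℝ E) (finrank ℝ F)),
          if i < s then 0 else T.singularValues i := by
  obtain ⟨v, u, hv, hu, hT⟩ := T.exists_singularValue_decomposition rfl
  let V : E →ₗ[ℝ] F := ∑ j : Fin (min (finrank ℝ E) (finrank ℝ F)),
    (if (j : ℕ) < s then T.singularValues j else 0) • (rankOne ℝ (u j) (v j) : E →ₗ[ℝ] F)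
  have hsub : T - V = 0 + ∑ j : Fin (min (finrank ℝ E) (finrank ℝ F)),
      (if (j : ℕ) < s then 0 else T.singularValues j) •
        (rankOne ℝ (u j) (v j) : E →ₗ[ℝ] F) := by
    conv_lhs => rw [hT]
    rw [zero_add, ← Finset.sum_sub_distrib]
    refine Finset.sum_congr rfl fun j _ => ?_
    rw [← sub_smul]
    split_ifs <;> simp
  refine ⟨V, ?_, ?_⟩
  · classical
    let J : Finset (Fin (min (finrank ℝ E) (finrank ℝ F))) :=
      Finset.univ.filter fun j => (j : ℕ) < s
    have hJ : J.card ≤ s := by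
      rw [← Finset.card_map Fin.valEmbedding]
      refine (Finset.card_le_card (t := Finset.range s) ?_).trans (Finset.card_range s).le
      intro i hi
      obtain ⟨j, hj, rfl⟩ := Finset.mem_map.1 hi
      exact Finset.mem_range.2 (Finset.mem_filter.1 hj).2
    have hle : LinearMap.range V ≤ Submodule.span ℝ (J.image u : Set F) := by
      rintro _ ⟨x, rfl⟩
      simp only [V, LinearMap.sum_apply, LinearMap.smul_apply, ContinuousLinearMap.coe_coe,
        rankOne_apply]
      refine Submodule.sum_mem _ fun j _ => ?_
      split_ifs with h
      · refine Submodule.smul_mem _ _ (Submodule.smul_mem _ _ (Submodule.subset_span ?_))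
        exact Finset.mem_image_of_mem u (Finset.mem_filter.2 ⟨Finset.mem_univ _, h⟩)
      · simp
    exact (Submodule.finrank_mono hle).trans
      ((finrank_span_finset_le_card _).trans (Finset.card_image_le.trans hJ))
  -- Mirsky from the zero map: the singular values of a combination of rank-one maps sum to at most
  -- its total weight.
  · have h := sum_abs_singularValues_sub_le 0 (T - V) _ u v
      (fun j => by split_ifs; exacts [le_rfl, T.singularValues_nonneg j]) hu.1 hv.1 hsub
    rw [Finset.sum_range (fun i => if i < s then 0 else T.singularValues i)]
    refine le_trans (Finset.sum_le_sum fun i _ => ?_) h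
    simpa using le_abs_self _

end LinearMap

/-! ### Head and tail sums, and best approximation -/

namespace LowRankRecovery

variable {n₁ n₂ : ℕ}

theorem singVal_neg (X : Matrix (Fin n₁) (Fin n₂) ℝ) (i : ℕ) : singVal (-X) i = singVal X i := by
  rw [singVal, singVal, map_neg, LinearMap.singularValues_neg]

theorem min_finrank_euclideanSpace :
    min (finrank ℝ (EuclideanSpace ℝ (Fin n₂))) (finrank ℝ (EuclideanSpace ℝ (Fin n₁))) =
      min n₁ n₂ := by
  simp [min_comm]

theorem singVal_eq_zero_of_rank_le {X : Matrix (Fin n₁) (Fin n₂) ℝ} {i : ℕ} (h : X.rank ≤ i) :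
    singVal X i = 0 := by
  rw [singVal, LinearMap.singularValues_eq_zero_iff_le_finrank_range]
  rwa [Matrix.rank_eq_finrank_range_toLin X (EuclideanSpace.basisFun _ ℝ).toBasis
    (EuclideanSpace.basisFun _ ℝ).toBasis, ← Matrix.toEuclideanLin_eq_toLin_orthonormal] at h

/-- **Mirsky's inequality** for the nuclear norm. -/
theorem sum_abs_singVal_sub_le (X Y : Matrix (Fin n₁) (Fin n₂) ℝ) :
    ∑ i ∈ Finset.range (min n₁ n₂), |singVal X i - singVal Y i| ≤ nuclearNorm (X - Y) := by
  obtain ⟨v, u, hv, hu, hT⟩ := (Matrix.toEuclideanLin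
    (X - Y)).exists_singularValue_decomposition (min_finrank_euclideanSpace (n₁ := n₁)).symm
  have h := LinearMap.sum_abs_singularValues_sub_le (Matrix.toEuclideanLin Y)
    (Matrix.toEuclideanLin X) _ u v
    (fun j => LinearMap.singularValues_nonneg (Matrix.toEuclideanLin (X - Y)) j) hu.1 hv.1
    (by rw [← hT, map_sub]; abel)
  rw [min_finrank_euclideanSpace] at h
  rw [nuclearNorm, Finset.sum_range (fun i => singVal (X - Y) i)]
  exact h

theorem sum_mul_singVal_le (w : ℕ → ℝ) (hw : ∀ i, |w i| ≤ 1) (X Y : Matrix (Fin n₁) (Fin n₂) ℝ) :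
    ∑ i ∈ Finset.range (min n₁ n₂), w i * singVal X i ≤
      ∑ i ∈ Finset.range (min n₁ n₂), w i * singVal Y i + nuclearNorm (X - Y) := by
  rw [← sub_le_iff_le_add', ← Finset.sum_sub_distrib]
  refine le_trans (Finset.sum_le_sum fun i _ => ?_) (sum_abs_singVal_sub_le X Y)
  rw [← mul_sub]
  refine (le_abs_self _).trans ?_
  rw [abs_mul]
  exact mul_le_of_le_one_left (abs_nonneg _) (hw i)

/-- The sum of the `s` largest singular values. -/
noncomputable def headSum (s : ℕ) (X : Matrix (Fin n₁) (Fin n₂) ℝ) : ℝ :=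
  ∑ i ∈ Finset.range (min n₁ n₂), if i < s then singVal X i else 0

/-- The sum of all but the `s` largest singular values. -/
noncomputable def tailSum (s : ℕ) (X : Matrix (Fin n₁) (Fin n₂) ℝ) : ℝ :=
  ∑ i ∈ Finset.range (min n₁ n₂), if i < s then 0 else singVal X i

theorem headSum_add_tailSum (s : ℕ) (X : Matrix (Fin n₁) (Fin n₂) ℝ) :
    headSum s X + tailSum s X = nuclearNorm X := by
  rw [headSum, tailSum, nuclearNorm, ← Finset.sum_add_distrib]
  exact Finset.sum_congr rfl fun i _ => by split_ifs <;> simp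

theorem mul_headSum_add_mul_tailSum (s : ℕ) (X : Matrix (Fin n₁) (Fin n₂) ℝ) (a b : ℝ) :
    a * headSum s X + b * tailSum s X =
      ∑ i ∈ Finset.range (min n₁ n₂), (if i < s then a else b) * singVal X i := by
  rw [headSum, tailSum, Finset.mul_sum, Finset.mul_sum, ← Finset.sum_add_distrib]
  exact Finset.sum_congr rfl fun i _ => by split_ifs <;> simp

theorem headSum_neg (s : ℕ) (X : Matrix (Fin n₁) (Fin n₂) ℝ) :
    headSum s (-X) = headSum s X := by
  simp_rw [headSum, singVal_neg]

theorem tailSum_neg (s : ℕ) (X : Matrix (Fin n₁) (Fin n₂) ℝ) :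
    tailSum s (-X) = tailSum s X := by
  simp_rw [tailSum, singVal_neg]

/-- The form in which Mirsky is used below. Weights `(1, 1)` give the triangle inequality, `(-1, 1)`
serve minimality and the strong property, and `(1, -ρ)` the stable property. -/
theorem mul_headSum_add_mul_tailSum_le (s : ℕ) (X Y : Matrix (Fin n₁) (Fin n₂) ℝ) {a b : ℝ}
    (ha : |a| ≤ 1) (hb : |b| ≤ 1) :
    a * headSum s X + b * tailSum s X ≤
      a * headSum s Y + b * tailSum s Y + nuclearNorm (X - Y) := by
  rw [mul_headSum_add_mul_tailSum, mul_headSum_add_mul_tailSum]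
  exact sum_mul_singVal_le _ (fun i => by split_ifs <;> assumption) X Y

theorem nuclearNorm_le_add (X Y : Matrix (Fin n₁) (Fin n₂) ℝ) :
    nuclearNorm X ≤ nuclearNorm Y + nuclearNorm (X - Y) := by
  have h := mul_headSum_add_mul_tailSum_le 0 X Y (a := 1) (b := 1) (by simp) (by simp)
  simpa only [one_mul, headSum_add_tailSum] using h

/-- In Mirsky's inequality the singular values of `W` vanish from index `s` on. -/
theorem tailSum_le_nuclearNorm_sub {s : ℕ} (Z : Matrix (Fin n₁) (Fin n₂) ℝ)
    {W : Matrix (Fin n₁) (Fin n₂) ℝ} (hW : W.rank ≤ s) : tailSum s Z ≤ nuclearNorm (Z - W) := by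
  refine le_trans (Finset.sum_le_sum fun i _ => ?_) (sum_abs_singVal_sub_le Z W)
  split_ifs with h
  · exact abs_nonneg _
  · rw [singVal_eq_zero_of_rank_le (hW.trans (not_lt.1 h)), sub_zero]
    exact le_abs_self _

theorem exists_rank_le_nuclearNorm_sub_le (s : ℕ) (Z : Matrix (Fin n₁) (Fin n₂) ℝ) :
    ∃ V : Matrix (Fin n₁) (Fin n₂) ℝ, V.rank ≤ s ∧ nuclearNorm (Z - V) ≤ tailSum s Z := by
  obtain ⟨V, hV, h⟩ :=
    (Matrix.toEuclideanLin Z).exists_finrank_range_le_sum_singularValues_sub_le s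
  rw [min_finrank_euclideanSpace] at h
  refine ⟨Matrix.toEuclideanLin.symm V, ?_, ?_⟩
  · rwa [Matrix.rank_eq_finrank_range_toLin _ (EuclideanSpace.basisFun _ ℝ).toBasis
      (EuclideanSpace.basisFun _ ℝ).toBasis, ← Matrix.toEuclideanLin_eq_toLin_orthonormal,
      LinearEquiv.apply_symm_apply]
  · simp only [nuclearNorm, singVal, map_sub, LinearEquiv.apply_symm_apply]
    exact h

theorem IsBestApprox.nuclearNorm_sub_eq {s : ℕ} {Z V : Matrix (Fin n₁) (Fin n₂) ℝ}
    (h : IsBestApprox s Z V) : nuclearNorm (Z - V) = tailSum s Z := by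
  obtain ⟨W, hW, hle⟩ := exists_rank_le_nuclearNorm_sub_le s Z
  exact ((h.2 W hW).trans hle).antisymm (tailSum_le_nuclearNorm_sub Z h.1)

/-- The triangle inequality suffices: the null space properties bound `‖Z_s‖_*` from above, so only
this direction is needed. -/
theorem IsBestApprox.headSum_le {s : ℕ} {Z V : Matrix (Fin n₁) (Fin n₂) ℝ}
    (h : IsBestApprox s Z V) : headSum s Z ≤ nuclearNorm V := by
  have h1 := nuclearNorm_le_add Z V
  rw [h.nuclearNorm_sub_eq, ← headSum_add_tailSum s Z] at h1
  linarith

/-- Comparing `Z - Z₀` with `-Z₀`, whose difference is `Z`, gives `tail - head ≤ tail Z₀ - head Z₀ +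
‖Z‖_*`, and `‖Z‖_* ≤ head Z₀ + tail Z₀`. -/
theorem tailSum_sub_le_of_nuclearNorm_le (s : ℕ) {Z₀ Z : Matrix (Fin n₁) (Fin n₂) ℝ}
    (h : nuclearNorm Z ≤ nuclearNorm Z₀) :
    tailSum s (Z - Z₀) ≤ headSum s (Z - Z₀) + 2 * tailSum s Z₀ := by
  have h1 := mul_headSum_add_mul_tailSum_le s (Z - Z₀) (-Z₀) (a := -1) (b := 1) (by simp) (by simp)
  rw [headSum_neg, tailSum_neg, sub_neg_eq_add, sub_add_cancel] at h1
  have h2 := headSum_add_tailSum s Z₀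
  linarith

/-! ### The Frobenius norm and distance to the kernel of `A` -/

theorem frobenius_norm_sq_eq (X : Matrix (Fin n₁) (Fin n₂) ℝ) :
    ‖X‖ ^ 2 = ∑ i, ∑ j, X i j ^ 2 := by
  rw [Matrix.frobenius_norm_def, ← Real.sqrt_eq_rpow, Real.sq_sqrt (by positivity)]
  simp

/-- Since `σ_j² = ‖X v_j‖²` is the sum of squared inner products of `v_j` with the rows of `X`,
Bessel's inequality applies row by row. -/
theorem sum_sq_singVal_le (X : Matrix (Fin n₁) (Fin n₂) ℝ) :
    ∑ i ∈ Finset.range (min n₁ n₂), singVal X i ^ 2 ≤ ‖X‖ ^ 2 := by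
  obtain ⟨v, u, hv, hu, hT⟩ := (Matrix.toEuclideanLin X).exists_singularValue_decomposition
    (min_finrank_euclideanSpace (n₁ := n₁)).symm
  have hTv : ∀ j, Matrix.toEuclideanLin X (v j) = singVal X j • u j := fun j => by
    conv_lhs => rw [hT]
    simp [orthonormal_iff_ite.1 hv, singVal]
  have hsq : ∀ j : Fin (min n₁ n₂),
      singVal X j ^ 2 = ∑ k, ⟪v j, WithLp.toLp 2 (X k)⟫_ℝ ^ 2 := fun j => by
    have h1 : ‖Matrix.toEuclideanLin X (v j)‖ ^ 2 = singVal X j ^ 2 := by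
      rw [hTv, norm_smul, hu.1 j, mul_one, Real.norm_eq_abs, sq_abs]
    rw [← h1, EuclideanSpace.norm_sq_eq]
    refine Finset.sum_congr rfl fun k _ => ?_
    rw [Real.norm_eq_abs, sq_abs]
    simp [Matrix.mulVec, EuclideanSpace.inner_eq_star_dotProduct]
  rw [Finset.sum_range (fun i => singVal X i ^ 2), frobenius_norm_sq_eq]
  simp_rw [hsq]
  rw [Finset.sum_comm]
  refine Finset.sum_le_sum fun k _ => ?_
  have h := hv.sum_inner_products_le (s := Finset.univ) (WithLp.toLp 2 (X k))
  rw [EuclideanSpace.norm_sq_eq] at h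
  simpa using h

/-- Cauchy–Schwarz over `min n₁ n₂` terms, with the cruder factor `n₁ n₂`. -/
theorem nuclearNorm_le_sqrt_mul_norm (X : Matrix (Fin n₁) (Fin n₂) ℝ) :
    nuclearNorm X ≤ √((n₁ : ℝ) * (n₂ : ℝ)) * ‖X‖ := by
  refine le_of_sq_le_sq ?_ (by positivity)
  have h := sq_sum_le_card_mul_sum_sq (s := Finset.range (min n₁ n₂)) (f := singVal X)
  have hmin : ((min n₁ n₂ : ℕ) : ℝ) ≤ (n₁ : ℝ) * n₂ := by
    rcases Nat.eq_zero_or_pos n₂ with h0 | h0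
    · simp [h0]
    · exact_mod_cast (min_le_left n₁ n₂).trans (Nat.le_mul_of_pos_right n₁ h0)
  rw [Finset.card_range] at h
  rw [mul_pow, Real.sq_sqrt (by positivity)]
  refine h.trans (mul_le_mul hmin (sum_sq_singVal_le X) ?_ (by positivity))
  exact Finset.sum_nonneg fun _ _ => sq_nonneg _

theorem exists_map_eq_zero_norm_sub_le {ι : Type*} [Fintype ι]
    (A : Matrix (Fin n₁) (Fin n₂) ℝ →ₗ[ℝ] EuclideanSpace ℝ ι) (H : Matrix (Fin n₁) (Fin n₂) ℝ) :
    ∃ K, A K = 0 ∧ ‖H - K‖ ≤ ‖A H‖ / minSingVal A := by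
  let φ : Matrix (Fin n₁) (Fin n₂) ℝ ≃ₗ[ℝ] EuclideanSpace ℝ (Fin n₁ × Fin n₂) :=
    (Matrix.stdBasis ℝ (Fin n₁) (Fin n₂)).equivFun.trans (WithLp.linearEquiv 2 ℝ _).symm
  let M := LinearMap.toMatrix (Matrix.stdBasis ℝ (Fin n₁) (Fin n₂))
      (EuclideanSpace.basisFun ι ℝ).toBasis A
  have hφ : ∀ X, Matrix.toEuclideanLin M (φ X) = A X := fun X => by
    have h := LinearMap.toMatrix_mulVec_repr (Matrix.stdBasis ℝ (Fin n₁) (Fin n₂))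
      (EuclideanSpace.basisFun ι ℝ).toBasis A X
    ext i
    exact congrFun h i
  have hnorm : ∀ X, ‖φ X‖ = ‖X‖ := fun X => by
    rw [← sq_eq_sq₀ (norm_nonneg _) (norm_nonneg _), frobenius_norm_sq_eq,
      EuclideanSpace.norm_sq_eq, Fintype.sum_prod_type]
    refine Finset.sum_congr rfl fun i _ => Finset.sum_congr rfl fun j _ => ?_
    rw [Real.norm_eq_abs, sq_abs]
    congr 1
  obtain ⟨y, hy, hle⟩ := (Matrix.toEuclideanLin M).exists_mem_ker_norm_sub_le (φ H)
  refine ⟨φ.symm y, ?_, ?_⟩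
  · rw [← hφ, LinearEquiv.apply_symm_apply, hy]
  · rw [← hnorm, map_sub, LinearEquiv.apply_symm_apply, ← hφ H]
    exact hle

/-! ### Error bounds for minimizers -/

variable {ι : Type*} [Fintype ι] {A : Matrix (Fin n₁) (Fin n₂) ℝ →ₗ[ℝ] EuclideanSpace ℝ ι}

theorem minSingVal_nonneg (A : Matrix (Fin n₁) (Fin n₂) ℝ →ₗ[ℝ] EuclideanSpace ℝ ι) :
    0 ≤ minSingVal A :=
  Real.sInf_nonneg fun _ ht => ht.1.le

theorem IsNuclearMinimizer.nuclearNorm_le {Z₀ Zhat : Matrix (Fin n₁) (Fin n₂) ℝ}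
    {e : EuclideanSpace ℝ ι} {ε : ℝ} (he : ‖e‖ ≤ ε)
    (h : IsNuclearMinimizer A (A Z₀ + e) ε Zhat) : nuclearNorm Zhat ≤ nuclearNorm Z₀ :=
  h.2 Z₀ (by simpa using he)

theorem IsNuclearMinimizer.norm_map_sub_le {Z₀ Zhat : Matrix (Fin n₁) (Fin n₂) ℝ}
    {e : EuclideanSpace ℝ ι} {ε : ℝ} (he : ‖e‖ ≤ ε)
    (h : IsNuclearMinimizer A (A Z₀ + e) ε Zhat) : ‖A (Zhat - Z₀)‖ ≤ 2 * ε := by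
  have h1 : A (Zhat - Z₀) = (A Zhat - (A Z₀ + e)) + e := by rw [map_sub]; abel
  rw [h1]
  linarith [norm_add_le (A Zhat - (A Z₀ + e)) e, h.1]

/-- The error bound, from the robust inequality for the error itself. -/
theorem nuclearNorm_sub_le_of_headSum_le {s : ℕ} {ρ τ : ℝ} (hρ : 0 < ρ) (hρ1 : ρ < 1) (hτ : 0 ≤ τ)
    {Z₀ Z₀s Zhat : Matrix (Fin n₁) (Fin n₂) ℝ} {e : EuclideanSpace ℝ ι} {ε : ℝ}
    (hbest : IsBestApprox s Z₀ Z₀s) (he : ‖e‖ ≤ ε)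
    (hmin : IsNuclearMinimizer A (A Z₀ + e) ε Zhat)
    (h : headSum s (Zhat - Z₀) ≤ ρ * tailSum s (Zhat - Z₀) + τ * ‖A (Zhat - Z₀)‖) :
    nuclearNorm (Zhat - Z₀) ≤
      2 * (1 + ρ) / (1 - ρ) * nuclearNorm (Z₀ - Z₀s) + 4 * τ / (1 - ρ) * ε := by
  have h1 := tailSum_sub_le_of_nuclearNorm_le s (hmin.nuclearNorm_le he)
  have h2 := mul_le_mul_of_nonneg_left (hmin.norm_map_sub_le he) hτ
  have hpos : 0 < 1 - ρ := sub_pos.2 hρ1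
  rw [← headSum_add_tailSum s, hbest.nuclearNorm_sub_eq, div_mul_eq_mul_div, div_mul_eq_mul_div,
    ← add_div, le_div_iff₀ hpos]
  set a := headSum s (Zhat - Z₀)
  set b := tailSum s (Zhat - Z₀)
  have h3 : a ≤ ρ * b + 2 * τ * ε := by linarith
  have h4 : (1 - ρ) * b ≤ 2 * τ * ε + 2 * tailSum s Z₀ := by linarith
  -- `(1 - ρ)(a + b) ≤ (1 + ρ)(1 - ρ) b + (1 - ρ) 2τε`, and `h4` bounds `(1 - ρ) b`; the `ε` terms
  -- add up to `4τε`.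
  have h5 := mul_le_mul_of_nonneg_left h3 hpos.le
  have h6 := mul_le_mul_of_nonneg_left h4 (by linarith : 0 ≤ 1 + ρ)
  linarith

end LowRankRecovery

end

open LowRankRecovery in
theorem corollary6p2 {n₁ n₂ : ℕ} {ι : Type*} [Fintype ι]
    (A : Matrix (Fin n₁) (Fin n₂) ℝ →ₗ[ℝ] EuclideanSpace ℝ ι) (s : ℕ) :
    -- (a) stable null space property
    (∀ ρ : ℝ, 0 < ρ → ρ < 1 → StableNSP A s ρ →
      ∀ (Z₀ Z₀s : Matrix (Fin n₁) (Fin n₂) ℝ) (e Y : EuclideanSpace ℝ ι) (ε : ℝ)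
        (Zhat : Matrix (Fin n₁) (Fin n₂) ℝ),
        IsBestApprox s Z₀ Z₀s → Y = A Z₀ + e → ‖e‖ ≤ ε → IsNuclearMinimizer A Y ε Zhat →
        nuclearNorm (Zhat - Z₀) ≤
          (2 + 2 * ρ) / (1 - ρ) * nuclearNorm (Z₀ - Z₀s) +
            4 * √((n₁ : ℝ) * (n₂ : ℝ)) / ((1 - ρ) * minSingVal A) * ε) ∧
    -- (b) robust null space property
    (∀ ρ τ : ℝ, 0 < ρ → ρ < 1 → 0 < τ → RobustNSP A s ρ τ →
      ∀ (Z₀ Z₀s : Matrix (Fin n₁) (Fin n₂) ℝ) (e Y : EuclideanSpace ℝ ι) (ε : ℝ)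
        (Zhat : Matrix (Fin n₁) (Fin n₂) ℝ),
        IsBestApprox s Z₀ Z₀s → Y = A Z₀ + e → ‖e‖ ≤ ε → IsNuclearMinimizer A Y ε Zhat →
        nuclearNorm (Zhat - Z₀) ≤
          2 * (1 + ρ) / (1 - ρ) * nuclearNorm (Z₀ - Z₀s) + 4 * τ / (1 - ρ) * ε) ∧
    -- (c) strong null space property
    (∀ c : ℝ, 0 < c → StrongNSP A s c →
      ∀ (Z₀ Z₀s : Matrix (Fin n₁) (Fin n₂) ℝ) (e Y : EuclideanSpace ℝ ι) (ε : ℝ)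
        (Zhat : Matrix (Fin n₁) (Fin n₂) ℝ),
        IsBestApprox s Z₀ Z₀s → Y = A Z₀ + e → ‖e‖ ≤ ε → IsNuclearMinimizer A Y ε Zhat →
        ‖Zhat - Z₀‖ ≤
          2 / minSingVal A * (√((n₁ : ℝ) * (n₂ : ℝ)) / c + 1) * ε +
            2 / c * nuclearNorm (Z₀ - Z₀s)) := by
  refine ⟨?_, ?_, ?_⟩
  · rintro ρ hρ hρ1 hA Z₀ Z₀s e _ ε Zhat hbest rfl he hmin
    have hν := minSingVal_nonneg A
    -- The stable property acts as a robust one with `τ = √(n₁ n₂) / ν_A`: `head - ρ tail` is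
    -- nonpositive at `K` and grows by at most `‖H - K‖_*` on passing to `H`.
    have hH : headSum s (Zhat - Z₀) ≤ ρ * tailSum s (Zhat - Z₀) +
        √((n₁ : ℝ) * (n₂ : ℝ)) / minSingVal A * ‖A (Zhat - Z₀)‖ := by
      obtain ⟨K, hK, hle⟩ := exists_map_eq_zero_norm_sub_le A (Zhat - Z₀)
      obtain ⟨Ks, hKs, hKle⟩ := hA K hK
      rw [hKs.nuclearNorm_sub_eq] at hKle
      have h1 := hKs.headSum_le
      have h2 := mul_headSum_add_mul_tailSum_le s (Zhat - Z₀) K (a := 1) (b := -ρ) (by simp)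
        (by rw [abs_neg, abs_of_pos hρ]; exact hρ1.le)
      have h3 := (nuclearNorm_le_sqrt_mul_norm (Zhat - Z₀ - K)).trans
        (mul_le_mul_of_nonneg_left hle (Real.sqrt_nonneg _))
      rw [div_mul_eq_mul_div, mul_div_assoc]
      linarith
    refine (nuclearNorm_sub_le_of_headSum_le hρ hρ1 (by positivity) hbest he hmin hH).trans_eq ?_
    rw [mul_div_assoc', div_div, mul_comm (minSingVal A), mul_add, mul_one]
  · rintro ρ τ hρ hρ1 hτ hA Z₀ Z₀s e _ ε Zhat hbest rfl he hmin
    refine nuclearNorm_sub_le_of_headSum_le hρ hρ1 hτ.le hbest he hmin ?_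
    obtain ⟨Hs, hHs, hle⟩ := hA (Zhat - Z₀)
    rw [hHs.nuclearNorm_sub_eq] at hle
    exact hHs.headSum_le.trans hle
  · rintro c hc hA Z₀ Z₀s e _ ε Zhat hbest rfl he hmin
    have hν := minSingVal_nonneg A
    obtain ⟨K, hK, hle⟩ := exists_map_eq_zero_norm_sub_le A (Zhat - Z₀)
    obtain ⟨Ks, hKs, hKle⟩ := hA K hK
    rw [hKs.nuclearNorm_sub_eq] at hKle
    have h1 := hKs.headSum_le
    -- The chain is `c ‖K‖ ≤ tail K - head K ≤ tail H - head H + ‖K - H‖_*`, and minimality bounds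
    -- `tail H - head H` by `2 tail Z₀`.
    have h2 := mul_headSum_add_mul_tailSum_le s K (Zhat - Z₀) (a := -1) (b := 1) (by simp)
      (by simp)
    have h3 := nuclearNorm_le_sqrt_mul_norm (K - (Zhat - Z₀))
    rw [norm_sub_rev] at h3
    have h4 := tailSum_sub_le_of_nuclearNorm_le s (hmin.nuclearNorm_le he)
    have h5 : ‖Zhat - Z₀ - K‖ ≤ 2 / minSingVal A * ε := by
      refine hle.trans ?_
      rw [div_mul_eq_mul_div]
      exact div_le_div_of_nonneg_right (hmin.norm_map_sub_le he) hν
    have h6 : ‖Zhat - Z₀‖ ≤ ‖Zhat - Z₀ - K‖ + ‖K‖ := by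
      simpa using norm_add_le (Zhat - Z₀ - K) K
    have h7 : ‖K‖ ≤ (2 * tailSum s Z₀ + √((n₁ : ℝ) * (n₂ : ℝ)) * ‖Zhat - Z₀ - K‖) / c := by
      rw [le_div_iff₀ hc]
      linarith
    rw [hbest.nuclearNorm_sub_eq]
    calc ‖Zhat - Z₀‖
        ≤ ‖Zhat - Z₀ - K‖ +
          (2 * tailSum s Z₀ + √((n₁ : ℝ) * (n₂ : ℝ)) * ‖Zhat - Z₀ - K‖) / c := by linarith
      _ ≤ 2 / minSingVal A * ε +
          (2 * tailSum s Z₀ + √((n₁ : ℝ) * (n₂ : ℝ)) * (2 / minSingVal A * ε)) / c := by gcongr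
      _ = _ := by ring
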